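/- Let $K$ be a field. Algebras are associative unital $K$-algebras and modules are left modules. For a function $f:\mathbb{N}\to\mathbb{N}\cup\{\infty\}$ put $$\gamma(f):=\inf\{r\in\mathbb{R}_{\ge 0}\mid f(i)\le i^r \text{ for all sufficiently large } i\}\in[0,\infty],\qquad \inf\emptyset=\infty .$$ Let $R$ be a finitely generated algebra with generators $a_1,\dots,a_s$ and standard filtration $R_0=K$, $R_1=K+\sum_k Ka_k$, $R_i=R_1^i$. Let $M$ be a finitely generated $R$-module, $M_0$ a finite dimensional subspace with $RM_0=M$, and $M_i=R_iM_0$. Put $$\mathrm{GK}(R):=\gamma(i\mapsto\dim_K R_i),\qquad \mathrm{GK}(M)=\mathrm{GK}({}_RM):=\gamma(i\mapsto\dim_K M_i),\qquad \mathrm{fdim}({}_RM):=\gamma(\nu),$$ where the return function $\nu(i)\in\mathbb{N}\cup\{\infty\}$ is the least $j$ such that $R_jV\supseteq M_0$ for every subspace $V\subseteq M_i$ with $RV=M$ (and $\nu(i)=\infty$ if there is no such $j\in\mathbb{N}$). These three quantities do not depend on the choice of the generators and of $M_0$. The filter dimension of the algebra $R$ is $\mathrm{fdim}(R):=\mathrm{fdim}({}_{R\otimes_K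 R^{op}}R)$, where $(a\otimes b)\cdot x=axb$, and its holonomic number is $$h_R:=\inf\{\mathrm{GK}(M)\mid M \text{ a nonzero finitely generated } R\text{-module}\}.$$ Let $A$ be a simple finitely generated $K$-algebra, $e=e^2$ a nonzero idempotent of $A$, and $B:=eAe$, an algebra with unit $e$. Then, for every nonzero finitely generated $B$-module $M$, $$\mathrm{GK}({}_BM)\ \ge\ h_A\ \ge\ \frac{\mathrm{GK}(A)}{\mathrm{fdim}(A)+\max\{\mathrm{fdim}(A),1\}},$$ as an inequality in $[0,\infty]$, where the fraction is read as $0$ if $\mathrm{fdim}(A)=\infty$. -/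

import Mathlib

open scoped TensorProduct ENNReal NNReal
open Filter

namespace FilterDimension

universe w u v

/-- The degree `γ(f) = inf {r | f(i) ≤ i ^ r for all i ≫ 0}`, an element of `[0, ∞]`, of a function
`f : ℕ → ℕ ∪ {∞}`. It is `∞` if there is no such `r`. -/
noncomputable def degree (f : ℕ → ℕ∞) : ℝ≥0∞ :=
  ⨅ (r : ℝ≥0) (_ : ∀ᶠ i : ℕ in atTop, (f i : ℝ≥0∞) ≤ (i : ℝ≥0∞) ^ (r : ℝ)), (r : ℝ≥0∞)

section Filtrations

variable (K : Type w) {A : Type u} [Field K] [Ring A] [Algebra K A]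

/-- A finite set of generators of the (associative unital) algebra `A`. -/
def Generates (S : Finset A) : Prop := Algebra.adjoin K (S : Set A) = ⊤

/-- The standard filtration `A₀ = K`, `A₁ = K + ∑ K a_k`, `A_i = A₁ ^ i` attached to the finite
set `S = {a_1, …, a_s}`. -/
def algFiltration (S : Finset A) (i : ℕ) : Submodule K A :=
  (1 ⊔ Submodule.span K (S : Set A)) ^ i

variable {K} {M : Type v} [AddCommGroup M] [Module K M] [Module A M] [IsScalarTower K A M]

variable (A) in
/-- A `K`-subspace `V` of `M` is generating if `A V = M`. -/
def IsGenerating (V : Submodule K M) : Prop := Submodule.span A (V : Set M) = ⊤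

/-- The standard filtration `M_i = A_i M₀` of a module with a generating subspace `M₀`. -/
def modFiltration (S : Finset A) (M₀ : Submodule K M) (i : ℕ) : Submodule K M :=
  algFiltration K S i • M₀

/-- The return function `ν(i)`: the least `j ∈ ℕ ∪ {∞}` such that `A_j V ⊇ M₀` for all generating
subspaces `V` of `M` that are contained in `M_i`. -/
noncomputable def returnFun (S : Finset A) (M₀ : Submodule K M) (i : ℕ) : ℕ∞ :=
  ⨅ (j : ℕ) (_ : ∀ V : Submodule K M, IsGenerating A V → V ≤ modFiltration S M₀ i →
    M₀ ≤ algFiltration K S j • V), (j : ℕ∞)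

end Filtrations

section Dimensions

variable (K : Type w) (A : Type u) [Field K] [Ring A] [Algebra K A]

/-- The Gelfand-Kirillov dimension `γ(i ↦ dim A_i)` of a finitely generated algebra. It is the same
for all finite sets of generators, see `gkDimAlg_eq`. -/
noncomputable def gkDimAlg : ℝ≥0∞ :=
  ⨅ (S : Finset A) (_ : Generates K S),
    degree fun i => (Module.finrank K (algFiltration K S i) : ℕ∞)

section Module

variable (M : Type v) [AddCommGroup M] [Module K M] [Module A M] [IsScalarTower K A M]

/-- The Gelfand-Kirillov dimension `γ(i ↦ dim M_i)` of a finitely generated module over a finitely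
generated algebra. It does not depend on the choices, see `gkDim_eq`. -/
noncomputable def gkDim : ℝ≥0∞ :=
  ⨅ (S : Finset A) (_ : Generates K S) (M₀ : Submodule K M) (_ : M₀.FG) (_ : IsGenerating A M₀),
    degree fun i => (Module.finrank K (modFiltration S M₀ i) : ℕ∞)

/-- The filter dimension `γ(ν)` of a finitely generated module over a finitely generated algebra.
It does not depend on the choices, see `filterDim_eq`. -/
noncomputable def filterDim : ℝ≥0∞ :=
  ⨅ (S : Finset A) (_ : Generates K S) (M₀ : Submodule K M) (_ : M₀.FG) (_ : IsGenerating A M₀),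
    degree (returnFun S M₀)

end Module

/-- `A` as a left module over `A ⊗ Aᵒᵖ`, with `(a ⊗ bᵒᵖ) • x = a x b`. -/
noncomputable abbrev bimodule : Module (A ⊗[K] Aᵐᵒᵖ) A := TensorProduct.Algebra.module

theorem bimodule_smul (a x : A) (b : Aᵐᵒᵖ) :
    (letI := bimodule K A; (a ⊗ₜ[K] b) • x) = a * x * b.unop := by
  let := bimodule K A
  simp [TensorProduct.Algebra.smul_def, mul_assoc]

theorem bimodule_isScalarTower :
    letI := bimodule K A; IsScalarTower K (A ⊗[K] Aᵐᵒᵖ) A :=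
  letI := bimodule K A
  { smul_assoc := fun r ab a => by
      change TensorProduct.Algebra.moduleAux _ _ = _ • TensorProduct.Algebra.moduleAux _ _
      simp }

/-- The filter dimension of the algebra `A`: the filter dimension of the `A ⊗ Aᵒᵖ`-module `A`. -/
noncomputable def filterDimAlg : ℝ≥0∞ :=
  letI := bimodule K A
  haveI := bimodule_isScalarTower K A
  filterDim K (A ⊗[K] Aᵐᵒᵖ) A

/-- The holonomic number `h_A`: the infimum of `GK(M)` over the nonzero finitely generated
left `A`-modules `M`. (Such a module is a quotient of some `A ^ n`, so up to isomorphism all of them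
live in the universe of `A`.) -/
noncomputable def holonomicNumber : ℝ≥0∞ :=
  ⨅ (M : Type u) (_ : AddCommGroup M) (_ : Module K M) (_ : Module A M) (_ : IsScalarTower K A M)
    (_ : Module.Finite A M) (_ : Nontrivial M), gkDim K A M

end Dimensions

section Corner

variable {K : Type w} {A : Type u} [Field K] [Ring A] [Algebra K A]

/-- The `K`-algebra structure `k ↦ k e` of the ring `e A e` (whose unit is `e`). -/
noncomputable instance cornerAlgebra {e : A} (he : IsIdempotentElem e) : Algebra K he.Corner :=
  letI : SMul K he.Corner :=
    ⟨fun k x => ⟨k • x.1, by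
      obtain ⟨a, ha⟩ := x.2
      exact ⟨k • a, by simp [← ha]⟩⟩⟩
  letI : Module K he.Corner :=
    { one_smul := fun x => Subtype.ext (one_smul K x.1)
      mul_smul := fun a b x => Subtype.ext (mul_smul a b x.1)
      smul_zero := fun a => Subtype.ext (smul_zero a)
      smul_add := fun a x y => Subtype.ext (smul_add a x.1 y.1)
      add_smul := fun a b x => Subtype.ext (add_smul a b x.1)
      zero_smul := fun x => Subtype.ext (zero_smul K x.1) }
  Algebra.ofModule (fun k x y => Subtype.ext (smul_mul_assoc k x.1 y.1))
    (fun k x y => Subtype.ext (mul_smul_comm k x.1 y.1))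

theorem coe_corner_smul {e : A} (he : IsIdempotentElem e) (k : K) (x : he.Corner) :
    ((k • x : he.Corner).1 : A) = k • x.1 := rfl

end Corner

section Independence

theorem degree_le {f g : ℕ → ℕ∞} (c d C : ℕ) (hc : 0 < c)
    (h : ∀ i, f i ≤ C * g (c * i + d) + C) : degree f ≤ degree g := by
  refine le_iInf₂ fun r hr => ENNReal.le_of_forall_pos_le_add fun ε hε _ => ?_
  have key : ∀ᶠ i : ℕ in atTop, (f i : ℝ≥0∞) ≤ (i : ℝ≥0∞) ^ ((r + ε : ℝ≥0) : ℝ) := by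
    have ht : Tendsto (fun i : ℕ => c * i + d) atTop atTop :=
      tendsto_atTop_mono (fun i => (Nat.le_mul_of_pos_left i hc).trans (Nat.le_add_right _ _))
        tendsto_id
    have h2 : Tendsto (fun i : ℕ => (i : ℝ) ^ (ε : ℝ)) atTop atTop :=
      (tendsto_rpow_atTop (by exact_mod_cast hε)).comp tendsto_natCast_atTop_atTop
    filter_upwards [ht.eventually hr, h2.eventually_ge_atTop ((C : ℝ) * (c + d : ℝ) ^ (r : ℝ) + C),
      eventually_ge_atTop 1] with i h1 h3 hi
    have hi' : (1 : ℝ) ≤ i := by exact_mod_cast hi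
    have hfi : (f i : ℝ≥0∞) ≤ C * (g (c * i + d) : ℝ≥0∞) + C := by
      have := ENat.toENNReal_le.2 (h i)
      simpa using this
    have hreal : (C : ℝ) * ((c * i + d : ℕ) : ℝ) ^ (r : ℝ) + C ≤ (i : ℝ) ^ ((r + ε : ℝ≥0) : ℝ) := by
      have e1 : ((c * i + d : ℕ) : ℝ) ≤ (c + d : ℝ) * i := by
        push_cast; nlinarith [(Nat.cast_nonneg d : (0 : ℝ) ≤ d)]
      have e2 : ((c * i + d : ℕ) : ℝ) ^ (r : ℝ) ≤ (c + d : ℝ) ^ (r : ℝ) * (i : ℝ) ^ (r : ℝ) := by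
        rw [← Real.mul_rpow (by positivity) (by positivity)]
        exact Real.rpow_le_rpow (by positivity) e1 r.2
      have e3 : (1 : ℝ) ≤ (i : ℝ) ^ (r : ℝ) := Real.one_le_rpow hi' r.2
      calc (C : ℝ) * ((c * i + d : ℕ) : ℝ) ^ (r : ℝ) + C
          ≤ C * ((c + d : ℝ) ^ (r : ℝ) * (i : ℝ) ^ (r : ℝ)) + C * (i : ℝ) ^ (r : ℝ) := by
            gcongr
            exact le_mul_of_one_le_right (by positivity) e3
        _ = (i : ℝ) ^ (r : ℝ) * ((C : ℝ) * (c + d : ℝ) ^ (r : ℝ) + C) := by ring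
        _ ≤ (i : ℝ) ^ (r : ℝ) * (i : ℝ) ^ (ε : ℝ) := by gcongr
        _ = _ := by rw [← Real.rpow_add (by positivity)]; simp
    have hpow : ∀ (n : ℕ) (s : ℝ≥0), (n : ℝ≥0∞) ^ (s : ℝ) = ENNReal.ofReal ((n : ℝ) ^ (s : ℝ)) :=
      fun n s => by
        rw [← ENNReal.ofReal_rpow_of_nonneg (Nat.cast_nonneg n) s.coe_nonneg,
          ENNReal.ofReal_natCast]
    calc (f i : ℝ≥0∞) ≤ C * (g (c * i + d) : ℝ≥0∞) + C := hfi
      _ ≤ C * ((c * i + d : ℕ) : ℝ≥0∞) ^ (r : ℝ) + C := by gcongr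
      _ = ENNReal.ofReal ((C : ℝ) * ((c * i + d : ℕ) : ℝ) ^ (r : ℝ) + C) := by
        rw [hpow, ENNReal.ofReal_add (by positivity) (by positivity),
          ENNReal.ofReal_mul (by positivity), ENNReal.ofReal_natCast]
      _ ≤ ENNReal.ofReal ((i : ℝ) ^ ((r + ε : ℝ≥0) : ℝ)) := ENNReal.ofReal_le_ofReal hreal
      _ = _ := (hpow _ _).symm
  exact (iInf₂_le (r + ε) key).trans (by simp)

variable {K : Type w} {A : Type u} [Field K] [Ring A] [Algebra K A]

theorem algFiltration_mono (S : Finset A) : Monotone (algFiltration K S) :=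
  fun _ _ h => pow_le_pow_right₀ le_sup_left h

theorem algFiltration_add (S : Finset A) (i j : ℕ) :
    algFiltration K S (i + j) = algFiltration K S i * algFiltration K S j := pow_add _ _ _

theorem algFiltration_fg (S : Finset A) (i : ℕ) : (algFiltration K S i).FG :=
  Submodule.FG.pow (Submodule.FG.sup ⟨{1}, by simp [Submodule.one_eq_span]⟩ ⟨S, rfl⟩) i

theorem exists_mem_algFiltration {S : Finset A} (hS : Generates K S) (a : A) :
    ∃ i, a ∈ algFiltration K S i := by
  have ha : a ∈ Algebra.adjoin K (S : Set A) := by rw [hS]; trivial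
  induction ha using Algebra.adjoin_induction with
  | mem x hx =>
    exact ⟨1, by rw [algFiltration, pow_one]; exact Submodule.mem_sup_right (Submodule.subset_span hx)⟩
  | algebraMap r => exact ⟨0, by rw [algFiltration, pow_zero]; exact Submodule.algebraMap_mem r⟩
  | add x y _ _ hx hy =>
    obtain ⟨i, hi⟩ := hx
    obtain ⟨j, hj⟩ := hy
    exact ⟨max i j, add_mem (algFiltration_mono S (le_max_left i j) hi)
      (algFiltration_mono S (le_max_right i j) hj)⟩
  | mul x y _ _ hx hy =>
    obtain ⟨i, hi⟩ := hx
    obtain ⟨j, hj⟩ := hy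
    exact ⟨i + j, by rw [algFiltration_add]; exact Submodule.mul_mem_mul hi hj⟩

theorem exists_algFiltration_le {T : Finset A} (S : Finset A) (hT : Generates K T) :
    ∃ c, 0 < c ∧ ∀ i, algFiltration K S i ≤ algFiltration K T (c * i) := by
  choose n hn using exists_mem_algFiltration hT
  refine ⟨S.sup n + 1, by omega, fun i => ?_⟩
  rw [algFiltration, algFiltration, pow_mul]
  refine pow_le_pow_left' (sup_le ?_ (Submodule.span_le.2 fun s hs => ?_)) i
  · exact one_le_pow₀ (le_sup_left)
  · exact algFiltration_mono T ((Finset.le_sup (f := n) hs).trans (Nat.le_succ _)) (hn s)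

/-- The Gelfand-Kirillov dimension of an algebra can be computed with any finite set of
generators. -/
theorem gkDimAlg_eq {S : Finset A} (hS : Generates K S) :
    gkDimAlg K A = degree fun i => (Module.finrank K (algFiltration K S i) : ℕ∞) := by
  refine le_antisymm (iInf₂_le S hS) (le_iInf₂ fun T hT => ?_)
  obtain ⟨c, hc, h⟩ := exists_algFiltration_le S hT
  refine degree_le c 0 1 hc fun i => ?_
  have : Module.Finite K (algFiltration K T (c * i)) :=
    Module.Finite.iff_fg.2 (algFiltration_fg T _)
  have := Submodule.finrank_mono (h i)
  simp only [Nat.cast_one, one_mul]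
  exact le_add_right (by exact_mod_cast this)

variable {M : Type v} [AddCommGroup M] [Module K M] [Module A M] [IsScalarTower K A M]

theorem modFiltration_fg (S : Finset A) {M₀ : Submodule K M} (h : M₀.FG) (i : ℕ) :
    (modFiltration S M₀ i).FG := by
  have : modFiltration S M₀ i =
      Submodule.map₂ (Algebra.lsmul K K M).toLinearMap (algFiltration K S i) M₀ := by
    refine le_antisymm (Submodule.smul_le.2 fun a ha m hm => ?_) (Submodule.map₂_le.2 fun a ha m hm => ?_)
    · exact Submodule.apply_mem_map₂ (Algebra.lsmul K K M).toLinearMap ha hm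
    · exact Submodule.smul_mem_smul ha hm
  rw [this]
  exact Submodule.FG.map₂ _ (algFiltration_fg S i) h

theorem algFiltration_smul_mono (S : Finset A) (V : Submodule K M) :
    Monotone fun i => algFiltration K S i • V :=
  fun _ _ h => Submodule.smul_mono_left (algFiltration_mono S h)

theorem algFiltration_smul_smul (S : Finset A) (V : Submodule K M) (i j : ℕ) :
    algFiltration K S i • algFiltration K S j • V = algFiltration K S (i + j) • V := by
  rw [algFiltration_add, ← smul_eq_mul, Submodule.smul_assoc]

theorem exists_le_modFiltration {S : Finset A} (hS : Generates K S) {M₀ N₀ : Submodule K M}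
    (hM : IsGenerating A M₀) (hN : N₀.FG) : ∃ d, N₀ ≤ modFiltration S M₀ d := by
  have hx : ∀ x : M, ∃ i, x ∈ modFiltration S M₀ i := fun x => by
    have hx : x ∈ Submodule.span A (M₀ : Set M) := by rw [hM]; trivial
    induction hx using Submodule.span_induction with
    | mem x hx =>
      exact ⟨0, by rw [modFiltration, algFiltration, pow_zero, Submodule.one_smul]; exact hx⟩
    | zero => exact ⟨0, zero_mem _⟩
    | add x y _ _ hx hy =>
      obtain ⟨i, hi⟩ := hx
      obtain ⟨j, hj⟩ := hy
      exact ⟨max i j, add_mem (algFiltration_smul_mono S M₀ (le_max_left i j) hi)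
        (algFiltration_smul_mono S M₀ (le_max_right i j) hj)⟩
    | smul a x _ hx =>
      obtain ⟨i, hi⟩ := hx
      obtain ⟨j, hj⟩ := exists_mem_algFiltration hS a
      exact ⟨j + i, by
        rw [modFiltration, ← algFiltration_smul_smul]; exact Submodule.smul_mem_smul hj hi⟩
  obtain ⟨s, rfl⟩ := hN
  choose n hn using hx
  exact ⟨s.sup n, Submodule.span_le.2 fun x hx =>
    algFiltration_smul_mono S M₀ (Finset.le_sup (f := n) hx) (hn x)⟩

/-- The Gelfand-Kirillov dimension of a module can be computed with any choice of a finite set of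
algebra generators and of a finite dimensional generating subspace. -/
theorem gkDim_eq {S : Finset A} (hS : Generates K S) {M₀ : Submodule K M} (hM : M₀.FG)
    (hM' : IsGenerating A M₀) :
    gkDim K A M = degree fun i => (Module.finrank K (modFiltration S M₀ i) : ℕ∞) := by
  refine le_antisymm (iInf₂_le_of_le S hS <| iInf₂_le_of_le M₀ hM <| iInf_le _ hM')
    (le_iInf₂ fun T hT => le_iInf₂ fun N₀ hN => le_iInf fun hN' => ?_)
  obtain ⟨c, hc, h⟩ := exists_algFiltration_le S hT
  obtain ⟨d, hd⟩ := exists_le_modFiltration hT hN' hM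
  refine degree_le c d 1 hc fun i => ?_
  have hle : modFiltration S M₀ i ≤ modFiltration T N₀ (c * i + d) := by
    rw [modFiltration, modFiltration, ← algFiltration_smul_smul]
    exact Submodule.smul_mono (h i) hd
  have : Module.Finite K (modFiltration T N₀ (c * i + d)) :=
    Module.Finite.iff_fg.2 (modFiltration_fg T hN _)
  have := Submodule.finrank_mono hle
  simp only [Nat.cast_one, one_mul]
  exact le_add_right (by exact_mod_cast this)

/-- The filter dimension of a module can be computed with any choice of a finite set of
algebra generators and of a finite dimensional generating subspace. -/
theorem filterDim_eq {S : Finset A} (hS : Generates K S) {M₀ : Submodule K M} (hM : M₀.FG)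
    (hM' : IsGenerating A M₀) : filterDim K A M = degree (returnFun S M₀) := by
  refine le_antisymm (iInf₂_le_of_le S hS <| iInf₂_le_of_le M₀ hM <| iInf_le _ hM')
    (le_iInf₂ fun T hT => le_iInf₂ fun N₀ hN => le_iInf fun hN' => ?_)
  obtain ⟨c, hc, h⟩ := exists_algFiltration_le S hT
  obtain ⟨c', hc', h'⟩ := exists_algFiltration_le T hS
  obtain ⟨d, hd⟩ := exists_le_modFiltration hT hN' hM
  refine degree_le c d (c' * (1 + d)) hc fun i => ?_
  by_cases htop : returnFun T N₀ (c * i + d) = ⊤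
  · rw [htop, ENat.mul_top (by positivity)]; simp
  have hex : ∃ j : ℕ, (∀ V : Submodule K M, IsGenerating A V →
      V ≤ modFiltration T N₀ (c * i + d) → N₀ ≤ algFiltration K T j • V) ∧
      (j : ℕ∞) ≤ returnFun T N₀ (c * i + d) := by
    by_contra! hcon
    have hlt : returnFun T N₀ (c * i + d) < returnFun T N₀ (c * i + d) + 1 := by
      exact ENat.lt_add_one_iff htop |>.2 le_rfl
    refine absurd (le_iInf₂ (a := returnFun T N₀ (c * i + d) + 1) fun j hj => ?_) (not_le.2 hlt)
    exact Order.add_one_le_of_lt (hcon j hj)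
  obtain ⟨j, hj, hjle⟩ := hex
  have hfin : returnFun S M₀ i ≤ ((c' * (d + j) : ℕ) : ℕ∞) := by
    refine iInf₂_le _ fun V hV hVi => ?_
    have hVi' : V ≤ modFiltration T N₀ (c * i + d) := by
      refine hVi.trans ?_
      rw [modFiltration, modFiltration, ← algFiltration_smul_smul]
      exact Submodule.smul_mono (h i) hd
    calc M₀ ≤ algFiltration K T d • N₀ := hd
      _ ≤ algFiltration K T d • algFiltration K T j • V := Submodule.smul_mono le_rfl (hj V hV hVi')
      _ = algFiltration K T (d + j) • V := algFiltration_smul_smul _ _ _ _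
      _ ≤ algFiltration K S (c' * (d + j)) • V := Submodule.smul_mono_left (h' _)
  refine hfin.trans ?_
  calc ((c' * (d + j) : ℕ) : ℕ∞) ≤ ((c' * (1 + d) * j + c' * (1 + d) : ℕ) : ℕ∞) := by
        exact_mod_cast by nlinarith [Nat.zero_le (c' * d * j)]
    _ ≤ _ := by push_cast; gcongr

end Independence

end FilterDimension

/-!
Both inequalities come from writing `1 = ∑ x_k a y_k` for a nonzero element `a` of the simple
algebra `A`.

*The lower bound for the holonomic number.* Let `ν` be the return function of the bimodule `A` with
generating subspace `K`. A nonzero `a ∈ A_i` spans a generating subspace of the bimodule, so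
`1 ∈ A_j a A_j` for all `j ≥ ν(i)` (`one_le_mul_span_mul`). If `a` annihilated the layer
`M_j = A_j M₀` of a module `M`, then `M₀ ⊆ A_j a A_j M₀ = A_j a M_j` would vanish. So `A_i` embeds
into `Hom_K(M_j, M_{j+i})`, which gives `dim A_i ≤ dim M_j * dim M_{j+i}`
(`finrank_algFiltration_le`). Taking `j ≈ i ^ r` with `r` slightly larger than `fdim(A)`, and hence
`j + i ≲ i ^ max(r, 1)`, one obtains `GK(A) ≤ GK(M) (fdim(A) + max(fdim(A), 1))`
(`degree_le_degree_mul`, `gkDimAlg_le_gkDim_mul`).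

*Modules over the corner.* Let `1 = ∑ x_k e y_k` and let `m_1, …, m_n` generate the `e A e`-module
`M`. The `A`-module `A e ⊗ M` induced from `M` is encoded as the quotient `N` of `A ^ n` by the
relations `f` with `∑ (e a f_i e) m_i = 0` for all `a ∈ A` (`inducedRelations`). It is nonzero, and
multiplication by the elements `e y_k` embeds it into a finite power of `M`
(`exists_injective_of_relations`). Inserting `∑ x_k e y_k` between the factors of a product of `i`
elements of `A_1` shows that `e y_k A_i e` lies in a layer of `e A e` of index linear in `i`
(`exists_cornerMap_mem`). Hence the embedding maps the `i`-th layer of `N` into a power of a layer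
of `M` of index linear in `i`, so `h_A ≤ GK(N) ≤ GK(M)` (`holonomicNumber_le_gkDim_corner`).
-/

namespace FilterDimension

universe w u v

/-! ### Estimates for degrees -/

theorem eventually_le_of_degree_lt {f : ℕ → ℕ∞} {r : ℝ≥0} (h : degree f < r) :
    ∀ᶠ i : ℕ in atTop, (f i : ℝ≥0∞) ≤ (i : ℝ≥0∞) ^ (r : ℝ) := by
  simp only [degree, iInf_lt_iff] at h
  obtain ⟨s, hs, hsr⟩ := h
  have hsr' : s ≤ r := by exact_mod_cast hsr.le
  filter_upwards [hs, eventually_ge_atTop 1] with i hi h1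
  exact hi.trans (ENNReal.rpow_le_rpow_of_exponent_le (by exact_mod_cast h1) (by exact_mod_cast hsr'))

theorem natCast_le_rpow_iff (n i : ℕ) (r : ℝ≥0) :
    (n : ℝ≥0∞) ≤ (i : ℝ≥0∞) ^ (r : ℝ) ↔ (n : ℝ) ≤ (i : ℝ) ^ (r : ℝ) := by
  rw [← ENNReal.ofReal_natCast n, ← ENNReal.ofReal_natCast i,
    ENNReal.ofReal_rpow_of_nonneg (Nat.cast_nonneg i) r.coe_nonneg,
    ENNReal.ofReal_le_ofReal_iff (by positivity)]

/-- The asymptotic estimate behind the filter inequality, for fixed exponents: with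
`j = ⌊i ^ r⌋`, both `j` and `j + i` are bounded by multiples of powers of `i`. -/
theorem degree_le_of_eventually_le {a m : ℕ → ℕ} {ν : ℕ → ℕ∞}
    (h : ∀ i j : ℕ, ν i ≤ j → a i ≤ m j * m (j + i)) {r s ε : ℝ≥0} (hr : 0 < r) (hε : 0 < ε)
    (hν : ∀ᶠ i : ℕ in atTop, (ν i : ℝ≥0∞) ≤ (i : ℝ≥0∞) ^ (r : ℝ))
    (hm : ∀ᶠ i : ℕ in atTop, ((m i : ℕ∞) : ℝ≥0∞) ≤ (i : ℝ≥0∞) ^ (s : ℝ)) :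
    degree (fun i => (a i : ℕ∞)) ≤ ((s * (r + max r 1) + ε : ℝ≥0) : ℝ≥0∞) := by
  refine iInf₂_le _ ?_
  simp only [ENat.toENNReal_coe, natCast_le_rpow_iff] at hm ⊢
  have hfloor : Tendsto (fun i : ℕ => ⌊(i : ℝ) ^ (r : ℝ)⌋₊) atTop atTop :=
    tendsto_nat_floor_atTop.comp
      ((tendsto_rpow_atTop (by exact_mod_cast hr)).comp tendsto_natCast_atTop_atTop)
  have hsum : Tendsto (fun i : ℕ => ⌊(i : ℝ) ^ (r : ℝ)⌋₊ + i) atTop atTop :=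
    tendsto_atTop_mono (fun i => Nat.le_add_left i _) tendsto_id
  have hpow : Tendsto (fun i : ℕ => (i : ℝ) ^ (ε : ℝ)) atTop atTop :=
    (tendsto_rpow_atTop (by exact_mod_cast hε)).comp tendsto_natCast_atTop_atTop
  filter_upwards [hν, hfloor.eventually hm, hsum.eventually hm,
    hpow.eventually_ge_atTop ((2 : ℝ) ^ (s : ℝ)), eventually_ge_atTop 1] with i h1 h2 h3 h4 hi
  have hi' : (1 : ℝ) ≤ i := by exact_mod_cast hi
  set j := ⌊(i : ℝ) ^ (r : ℝ)⌋₊ with hj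
  have hji : (j : ℝ) ≤ (i : ℝ) ^ (r : ℝ) := Nat.floor_le (by positivity)
  have hνj : ν i ≤ j := by
    have hne : ν i ≠ ⊤ := fun htop => by
      rw [htop, ENat.toENNReal_top, top_le_iff] at h1
      exact ENNReal.rpow_ne_top_of_nonneg r.coe_nonneg (ENNReal.natCast_ne_top i) h1
    lift ν i to ℕ using hne with k
    rw [ENat.toENNReal_coe, natCast_le_rpow_iff] at h1
    exact_mod_cast Nat.le_floor h1
  set q : ℝ := max (r : ℝ) 1 with hq
  have hle : ((j + i : ℕ) : ℝ) ≤ 2 * (i : ℝ) ^ q := by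
    have e1 : (i : ℝ) ^ (r : ℝ) ≤ (i : ℝ) ^ q :=
      Real.rpow_le_rpow_of_exponent_le hi' (le_max_left _ _)
    have e2 : (i : ℝ) ^ (1 : ℝ) ≤ (i : ℝ) ^ q :=
      Real.rpow_le_rpow_of_exponent_le hi' (le_max_right _ _)
    rw [Real.rpow_one] at e2
    push_cast
    linarith
  calc (a i : ℝ) ≤ m j * m (j + i) := by exact_mod_cast h i j hνj
    _ ≤ (j : ℝ) ^ (s : ℝ) * ((j + i : ℕ) : ℝ) ^ (s : ℝ) := by gcongr
    _ ≤ ((i : ℝ) ^ (r : ℝ)) ^ (s : ℝ) * (2 * (i : ℝ) ^ q) ^ (s : ℝ) := by gcongr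
    _ = (i : ℝ) ^ (r * s : ℝ) * (i : ℝ) ^ (q * s) * 2 ^ (s : ℝ) := by
      rw [Real.mul_rpow (by positivity) (by positivity), ← Real.rpow_mul (by positivity),
        ← Real.rpow_mul (by positivity)]
      ring
    _ ≤ (i : ℝ) ^ (r * s : ℝ) * (i : ℝ) ^ (q * s) * (i : ℝ) ^ (ε : ℝ) := by gcongr
    _ = _ := by
      rw [← Real.rpow_add (by positivity), ← Real.rpow_add (by positivity)]
      congr 1
      push_cast
      ring

/-- The assumption `degree ν ≠ ∞` is needed: the right-hand side is `0 * ∞ = 0` if `m` has degree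
`0` and `ν` has degree `∞`. -/
theorem degree_le_degree_mul {a m : ℕ → ℕ} {ν : ℕ → ℕ∞}
    (h : ∀ i j : ℕ, ν i ≤ j → a i ≤ m j * m (j + i)) (hν : degree ν ≠ ⊤) :
    degree (fun i => (a i : ℕ∞)) ≤
      degree (fun i => (m i : ℕ∞)) * (degree ν + max (degree ν) 1) := by
  by_cases hm : degree (fun i => (m i : ℕ∞)) = ⊤
  · rw [hm, ENNReal.top_mul]
    · exact le_top
    · exact (lt_of_lt_of_le zero_lt_one ((le_max_right _ _).trans le_add_self)).ne'
  lift degree ν to ℝ≥0 using hν with f hf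
  lift degree (fun i => (m i : ℕ∞)) to ℝ≥0 using hm with g hg
  -- Apply the estimate to the exponents `f + t` and `g + t`, and let `t` tend to `0`.
  have hlim : Tendsto (fun t : ℝ≥0 => (((g + t) * ((f + t) + max (f + t) 1) + t : ℝ≥0) : ℝ≥0∞))
      (nhdsWithin 0 (Set.Ioi 0)) (nhds ((g * (f + max f 1) : ℝ≥0) : ℝ≥0∞)) := by
    refine ENNReal.tendsto_coe.2 (tendsto_nhdsWithin_of_tendsto_nhds ?_)
    have : Continuous fun t : ℝ≥0 => (g + t) * ((f + t) + max (f + t) 1) + t := by fun_prop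
    simpa using this.tendsto 0
  have key : degree (fun i => (a i : ℕ∞)) ≤ ((g * (f + max f 1) : ℝ≥0) : ℝ≥0∞) := by
    refine ge_of_tendsto hlim ?_
    filter_upwards [self_mem_nhdsWithin] with t ht
    have ht : 0 < t := ht
    refine degree_le_of_eventually_le h (by positivity) ht
      (eventually_le_of_degree_lt ?_) (eventually_le_of_degree_lt ?_)
    · rw [← hf]; exact_mod_cast lt_add_of_pos_right f ht
    · rw [← hg]; exact_mod_cast lt_add_of_pos_right g ht
  simpa using key

/-! ### The regular bimodule of a simple algebra and its return function -/

theorem exists_sum_mul_mul_eq_one {A : Type u} [Ring A] [IsSimpleRing A] {a : A} (ha : a ≠ 0) :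
    ∃ (ι : Type) (_ : Fintype ι) (x y : ι → A), ∑ k, x k * a * y k = 1 := by
  have h : (1 : A) ∈ TwoSidedIdeal.span {a} :=
    IsSimpleRing.one_mem_of_ne_zero_mem _ ha (TwoSidedIdeal.subset_span rfl)
  rw [TwoSidedIdeal.mem_span_iff_mem_addSubgroup_closure] at h
  generalize (1 : A) = z at h ⊢
  induction h using AddSubgroup.closure_induction with
  | mem z hz =>
    obtain ⟨_, ⟨x, -, _, rfl, rfl⟩, y, -, rfl⟩ := hz
    exact ⟨Unit, inferInstance, fun _ => x, fun _ => y, by simp⟩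
  | zero => exact ⟨Empty, inferInstance, Empty.elim, Empty.elim, by simp⟩
  | add z z' _ _ hz hz' =>
    obtain ⟨ι, _, x, y, hz⟩ := hz
    obtain ⟨κ, _, x', y', hz'⟩ := hz'
    exact ⟨ι ⊕ κ, inferInstance, Sum.elim x x', Sum.elim y y', by simp [hz, hz']⟩
  | neg z _ hz =>
    obtain ⟨ι, _, x, y, hz⟩ := hz
    exact ⟨ι, inferInstance, -x, y, by simp [hz]⟩

section Bimodule

variable {K : Type w} {A : Type u} [Field K] [Ring A] [Algebra K A]

attribute [local instance] bimodule
attribute [local instance] bimodule_isScalarTower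

open Classical in
/-- The generators `a ⊗ 1` and `1 ⊗ a`, `a ∈ S`, of the enveloping algebra `A ⊗ Aᵒᵖ`. -/
noncomputable def envelopingGenerators (K : Type w) {A : Type u} [Field K] [Ring A] [Algebra K A]
    (S : Finset A) : Finset (A ⊗[K] Aᵐᵒᵖ) :=
  S.image (fun a => a ⊗ₜ[K] 1) ∪ S.image fun a => 1 ⊗ₜ[K] MulOpposite.op a

theorem tmul_one_mem_envelopingGenerators {S : Finset A} {a : A} (ha : a ∈ S) :
    a ⊗ₜ[K] (1 : Aᵐᵒᵖ) ∈ envelopingGenerators K S :=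
  by classical exact Finset.mem_union_left _ (Finset.mem_image_of_mem _ ha)

theorem one_tmul_mem_envelopingGenerators {S : Finset A} {a : A} (ha : a ∈ S) :
    (1 : A) ⊗ₜ[K] MulOpposite.op a ∈ envelopingGenerators K S :=
  by classical exact Finset.mem_union_right _ (Finset.mem_image_of_mem _ ha)

theorem generates_envelopingGenerators {S : Finset A} (hS : Generates K S) :
    Generates K (envelopingGenerators K S) := by
  rw [Generates, eq_top_iff]
  set E := Algebra.adjoin K (envelopingGenerators K S : Set (A ⊗[K] Aᵐᵒᵖ))
  have hl : (⊤ : Subalgebra K A) ≤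
      E.comap (Algebra.TensorProduct.includeLeft : A →ₐ[K] A ⊗[K] Aᵐᵒᵖ) := by
    rw [← hS, Algebra.adjoin_le_iff]
    exact fun a ha => Algebra.subset_adjoin (tmul_one_mem_envelopingGenerators ha)
  have hr : (⊤ : Subalgebra K Aᵐᵒᵖ) ≤
      E.comap (Algebra.TensorProduct.includeRight : Aᵐᵒᵖ →ₐ[K] A ⊗[K] Aᵐᵒᵖ) := by
    rw [← Subalgebra.op_top, ← hS, Subalgebra.op_adjoin, Algebra.adjoin_le_iff]
    exact fun a ha => Algebra.subset_adjoin (one_tmul_mem_envelopingGenerators ha)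
  rintro t -
  induction t using TensorProduct.induction_on with
  | zero => exact zero_mem E
  | add s t hs ht => exact add_mem hs ht
  | tmul a b =>
    have : a ⊗ₜ[K] b = (a ⊗ₜ[K] 1) * (1 ⊗ₜ[K] b) := by simp
    rw [this]
    exact mul_mem (hl (x := a) trivial) (hr (x := b) trivial)

/-- The `i`-th layer of the enveloping algebra moves `V` into `A_i V A_i`: a generator multiplies by
an element of `A_1` on one side and by `1 ∈ A_1` on the other. -/
theorem algFiltration_envelopingGenerators_smul_le (S : Finset A) (V : Submodule K A) (i : ℕ) :
    algFiltration K (envelopingGenerators K S) i • V ≤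
      algFiltration K S i * V * algFiltration K S i := by
  induction i with
  | zero =>
    simp only [algFiltration, pow_zero, one_mul, mul_one]
    exact (Submodule.one_smul (A := A ⊗[K] Aᵐᵒᵖ) V).le
  | succ i ih =>
    have hone : ∀ W : Submodule K A, algFiltration K (envelopingGenerators K S) 1 • W ≤
        algFiltration K S 1 * W * algFiltration K S 1 := fun W => by
      have h1 : (1 : A) ∈ algFiltration K S 1 := by
        rw [algFiltration, pow_one]
        exact Submodule.mem_sup_left (Submodule.one_le.1 le_rfl)
      have hS : ∀ a ∈ S, a ∈ algFiltration K S 1 := fun a ha => by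
        rw [algFiltration, pow_one]
        exact Submodule.mem_sup_right (Submodule.subset_span ha)
      rw [algFiltration, pow_one, Submodule.sup_smul, Submodule.one_smul]
      refine sup_le (fun x hx => ?_) ?_
      · simpa using Submodule.mul_mem_mul (Submodule.mul_mem_mul h1 hx) h1
      · refine Submodule.smul_le.2 fun t ht x hx => ?_
        induction ht using Submodule.span_induction with
        | zero => exact (zero_smul (A ⊗[K] Aᵐᵒᵖ) x).symm ▸ zero_mem _
        | add s t _ _ hs ht => rw [add_smul]; exact add_mem hs ht
        | smul k t _ ht => rw [smul_assoc]; exact Submodule.smul_mem _ k ht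
        | mem t ht =>
          simp only [envelopingGenerators, Finset.coe_union, Finset.coe_image, Set.mem_union,
            Set.mem_image, Finset.mem_coe] at ht
          obtain ⟨a, ha, rfl⟩ | ⟨a, ha, rfl⟩ := ht
          · rw [bimodule_smul]
            exact Submodule.mul_mem_mul (Submodule.mul_mem_mul (hS a ha) hx) h1
          · rw [bimodule_smul]
            exact Submodule.mul_mem_mul (Submodule.mul_mem_mul h1 hx) (hS a ha)
    calc algFiltration K (envelopingGenerators K S) (i + 1) • V
        = algFiltration K (envelopingGenerators K S) 1 •
            algFiltration K (envelopingGenerators K S) i • V := by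
          rw [algFiltration_smul_smul, add_comm]
      _ ≤ algFiltration K (envelopingGenerators K S) 1 •
            (algFiltration K S i * V * algFiltration K S i) := Submodule.smul_mono le_rfl ih
      _ ≤ algFiltration K S 1 * (algFiltration K S i * V * algFiltration K S i) *
            algFiltration K S 1 := hone _
      _ = algFiltration K S (i + 1) * V * algFiltration K S (i + 1) := by
          conv_rhs => rw [algFiltration_add, ← algFiltration_add, add_comm i 1,
            algFiltration_add S 1 i]
          conv_rhs => enter [2]; rw [← algFiltration_add, add_comm 1 i, algFiltration_add]
          simp only [mul_assoc]

theorem algFiltration_le_modFiltration_enveloping (S : Finset A) (i : ℕ) :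
    algFiltration K S i ≤ modFiltration (envelopingGenerators K S) (1 : Submodule K A) i := by
  intro a ha
  have hle : Submodule.map
      (Algebra.TensorProduct.includeLeft : A →ₐ[K] A ⊗[K] Aᵐᵒᵖ).toLinearMap
      (algFiltration K S i) ≤ algFiltration K (envelopingGenerators K S) i := by
    rw [algFiltration, Submodule.map_pow, algFiltration, Submodule.map_sup, Submodule.map_one,
      Submodule.map_span]
    refine pow_le_pow_left' (sup_le_sup le_rfl (Submodule.span_mono ?_)) i
    rintro _ ⟨a, ha, rfl⟩
    exact tmul_one_mem_envelopingGenerators ha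
  have := Submodule.smul_mem_smul (hle (Submodule.mem_map_of_mem ha))
    (Submodule.one_le.1 (le_refl (1 : Submodule K A)))
  rw [AlgHom.toLinearMap_apply, Algebra.TensorProduct.includeLeft_apply, bimodule_smul,
    MulOpposite.unop_one, mul_one, mul_one] at this
  exact this

theorem isGenerating_span_singleton [IsSimpleRing A] {a : A} (ha : a ≠ 0) :
    IsGenerating (A ⊗[K] Aᵐᵒᵖ) (Submodule.span K {a}) := by
  obtain ⟨ι, _, x, y, h⟩ := exists_sum_mul_mul_eq_one ha
  have h1 : (1 : A) ∈ Submodule.span (A ⊗[K] Aᵐᵒᵖ) (Submodule.span K {a} : Set A) := by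
    rw [← h]
    refine sum_mem fun k _ => ?_
    have := Submodule.smul_mem (Submodule.span (A ⊗[K] Aᵐᵒᵖ) (Submodule.span K {a} : Set A))
      (x k ⊗ₜ[K] MulOpposite.op (y k))
      (Submodule.subset_span (Submodule.mem_span_singleton_self a))
    rwa [bimodule_smul] at this
  refine eq_top_iff.2 fun b _ => ?_
  have := Submodule.smul_mem _ (b ⊗ₜ[K] (1 : Aᵐᵒᵖ)) h1
  rw [bimodule_smul] at this
  simpa using this

theorem filterDimAlg_eq [IsSimpleRing A] {S : Finset A} (hS : Generates K S) :
    filterDimAlg K A = degree (returnFun (envelopingGenerators K S) (1 : Submodule K A)) := by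
  refine filterDim_eq (generates_envelopingGenerators hS) ?_ ?_
  · exact ⟨{1}, by simp [Submodule.one_eq_span]⟩
  · rw [Submodule.one_eq_span]
    exact isGenerating_span_singleton one_ne_zero

/-- If `j ≥ ν(i)`, where `ν` is the return function of the bimodule `A` with respect to `K`, then
`1 ∈ A_j a A_j` for every nonzero `a ∈ A_i`: as `A` is simple, `K a` is a generating subspace of the
bimodule. -/
theorem one_le_mul_span_mul [IsSimpleRing A] {S : Finset A} {i j : ℕ}
    (hj : returnFun (envelopingGenerators K S) (1 : Submodule K A) i ≤ j) {a : A}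
    (ha : a ∈ algFiltration K S i) (ha0 : a ≠ 0) :
    1 ≤ algFiltration K S j * Submodule.span K {a} * algFiltration K S j := by
  have hlt : returnFun (envelopingGenerators K S) (1 : Submodule K A) i < (j + 1 : ℕ) :=
    hj.trans_lt (by exact_mod_cast Nat.lt_succ_self j)
  simp only [returnFun, iInf_lt_iff] at hlt
  obtain ⟨l, hl, hlj⟩ := hlt
  have hlj : l ≤ j := Nat.lt_succ_iff.1 (by exact_mod_cast hlj)
  have hV : Submodule.span K {a} ≤ modFiltration (envelopingGenerators K S) 1 i :=
    (Submodule.span_singleton_le_iff_mem _ _).2 (algFiltration_le_modFiltration_enveloping S i ha)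
  calc 1 ≤ algFiltration K (envelopingGenerators K S) l • Submodule.span K {a} :=
        hl _ (isGenerating_span_singleton ha0) hV
    _ ≤ algFiltration K S l * Submodule.span K {a} * algFiltration K S l :=
        algFiltration_envelopingGenerators_smul_le S _ l
    _ ≤ _ := by gcongr <;> exact algFiltration_mono S hlj

variable {M : Type v} [AddCommGroup M] [Module K M] [Module A M] [IsScalarTower K A M]

/-- For `j ≥ ν(i)`, a nonzero `a ∈ A_i` does not annihilate `M_j`, because `1 ∈ A_j a A_j`. Hence
`A_i` embeds into `Hom_K(M_j, M_{j+i})`. -/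
theorem finrank_algFiltration_le [IsSimpleRing A] {S : Finset A} {M₀ : Submodule K M}
    (hfg : M₀.FG) (hM₀ : M₀ ≠ ⊥) {i j : ℕ}
    (hj : returnFun (envelopingGenerators K S) (1 : Submodule K A) i ≤ j) :
    Module.finrank K (algFiltration K S i) ≤
      Module.finrank K (modFiltration S M₀ j) * Module.finrank K (modFiltration S M₀ (j + i)) := by
  have hfin : ∀ l, Module.Finite K (modFiltration S M₀ l) :=
    fun l => Module.Finite.iff_fg.2 (modFiltration_fg S hfg l)
  have hmem : ∀ a : algFiltration K S i, ∀ m : modFiltration S M₀ j,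
      a.1 • m.1 ∈ modFiltration S M₀ (j + i) := fun a m => by
    rw [modFiltration, add_comm, ← algFiltration_smul_smul]
    exact Submodule.smul_mem_smul a.2 m.2
  let φ : algFiltration K S i →ₗ[K] modFiltration S M₀ j →ₗ[K] modFiltration S M₀ (j + i) :=
    LinearMap.mk₂ K (fun a m => ⟨a.1 • m.1, hmem a m⟩)
      (fun a b m => Subtype.ext (add_smul a.1 b.1 m.1))
      (fun k a m => Subtype.ext (smul_assoc k a.1 m.1))
      (fun a m n => Subtype.ext (smul_add a.1 m.1 n.1))
      (fun k a m => Subtype.ext (smul_algebra_smul_comm k a.1 m.1))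
  have hφ : Function.Injective φ := by
    refine (injective_iff_map_eq_zero φ).2 fun a ha => ?_
    by_contra ha0
    have ha0 : a.1 ≠ 0 := fun h => ha0 (Subtype.ext h)
    have hkill : Submodule.span K {a.1} • modFiltration S M₀ j ≤ ⊥ := by
      refine Submodule.smul_le.2 fun b hb m hm => ?_
      obtain ⟨k, rfl⟩ := Submodule.mem_span_singleton.1 hb
      have : a.1 • m = 0 := congrArg Subtype.val (LinearMap.congr_fun ha ⟨m, hm⟩)
      rw [smul_assoc, this, smul_zero]
      exact zero_mem _
    refine hM₀ (le_bot_iff.1 ?_)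
    calc M₀ = (1 : Submodule K A) • M₀ := (Submodule.one_smul _).symm
      _ ≤ (algFiltration K S j * Submodule.span K {a.1} * algFiltration K S j) • M₀ :=
        Submodule.smul_mono_left (one_le_mul_span_mul hj a.2 ha0)
      _ = algFiltration K S j • Submodule.span K {a.1} • modFiltration S M₀ j := by
        rw [← smul_eq_mul, ← smul_eq_mul, Submodule.smul_assoc, Submodule.smul_assoc, modFiltration]
      _ ≤ algFiltration K S j • ⊥ := Submodule.smul_mono le_rfl hkill
      _ ≤ ⊥ := by rw [Submodule.smul_bot]
  calc _ ≤ Module.finrank K (modFiltration S M₀ j →ₗ[K] modFiltration S M₀ (j + i)) :=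
        LinearMap.finrank_le_finrank_of_injective hφ
    _ = _ := Module.finrank_linearMap K K _ _

end Bimodule

/-! ### The filter inequality -/

section Inequality

theorem isGenerating_span_range (K : Type w) (A : Type u) [Field K] [Ring A] (M : Type v)
    [AddCommGroup M] [Module K M] [Module A M] {ι : Type*} {m : ι → M}
    (hm : Submodule.span A (Set.range m) = ⊤) :
    IsGenerating A (Submodule.span K (Set.range m)) :=
  top_le_iff.1 (hm.ge.trans (Submodule.span_mono Submodule.subset_span))

variable (K : Type w) (A : Type u) [Field K] [Ring A] [Algebra K A]
variable (M : Type v) [AddCommGroup M] [Module K M] [Module A M] [IsScalarTower K A M]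

/-- The filter inequality `GK(A) ≤ GK(M) (fdim(A) + max(fdim(A), 1))`. -/
theorem gkDimAlg_le_gkDim_mul [IsSimpleRing A] [Algebra.FiniteType K A] [Module.Finite A M]
    [Nontrivial M] (hfdim : filterDimAlg K A ≠ ⊤) :
    gkDimAlg K A ≤ gkDim K A M * (filterDimAlg K A + max (filterDimAlg K A) 1) := by
  obtain ⟨S, hS⟩ : ∃ S : Finset A, Generates K S := Algebra.FiniteType.out
  obtain ⟨n, m, hm⟩ := Module.Finite.exists_fin (R := A) (M := M)
  have hfg : (Submodule.span K (Set.range m)).FG := Submodule.fg_span (Set.finite_range m)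
  have hgen := isGenerating_span_range K A M hm
  have hne : Submodule.span K (Set.range m) ≠ ⊥ := fun h => by
    rw [IsGenerating, h] at hgen
    simp at hgen
  rw [filterDimAlg_eq hS] at hfdim ⊢
  rw [gkDimAlg_eq hS, gkDim_eq hS hfg hgen]
  exact degree_le_degree_mul (fun i j hj => finrank_algFiltration_le hfg hne hj) hfdim

theorem div_le_holonomicNumber [IsSimpleRing A] [Algebra.FiniteType K A] :
    gkDimAlg K A / (filterDimAlg K A + max (filterDimAlg K A) 1) ≤ holonomicNumber K A := by
  by_cases htop : filterDimAlg K A = ⊤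
  -- Here the fraction is `0`, also for `GK(A) = ∞`, since `∞ / ∞ = 0` in `[0, ∞]`.
  · simp [htop]
  refine le_iInf fun M => le_iInf fun _ => le_iInf fun _ => le_iInf fun _ => le_iInf fun _ =>
    le_iInf fun _ => le_iInf fun _ => ?_
  exact ENNReal.div_le_of_le_mul (gkDimAlg_le_gkDim_mul K A M htop)

end Inequality

/-! ### The filtration of a corner -/

section Corner

variable {K : Type w} {A : Type u} [Field K] [Ring A] [Algebra K A]

variable (K) in
/-- The `K`-linear projection `a ↦ e a e` of `A` onto the corner `e A e`. -/
noncomputable def cornerMap {e : A} (he : IsIdempotentElem e) : A →ₗ[K] he.Corner where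
  toFun a := ⟨e * a * e, ⟨a, rfl⟩⟩
  map_add' a b := Subtype.ext (by simp only [mul_add, add_mul]; rfl)
  map_smul' k a := Subtype.ext <|
    show e * (k • a) * e = k • (e * a * e) by simp

variable {e : A} (he : IsIdempotentElem e)

theorem coe_cornerMap (a : A) : (cornerMap K he a).1 = e * a * e := rfl

theorem cornerMap_one : cornerMap K he 1 = 1 :=
  Subtype.ext (by rw [coe_cornerMap, mul_one, he.eq]; rfl)

variable {ι : Type*} [Fintype ι] {x y : ι → A}

/-- A relation `∑ x_k e y_k = 1` turns the projection onto the corner into a matrix-valued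
multiplicative map. -/
theorem cornerMap_mul (hxy : ∑ k, x k * e * y k = 1) (a b : A) :
    cornerMap K he (a * b) = ∑ k, cornerMap K he (a * x k) * cornerMap K he (y k * b) := by
  have h : a * b = ∑ k, a * x k * e * (y k * b) := by
    conv_lhs => rw [← mul_one a, ← hxy, Finset.mul_sum, Finset.sum_mul]
    simp only [mul_assoc]
  have h2 : ∀ c d : A, cornerMap K he (c * e * d) = cornerMap K he c * cornerMap K he d :=
    fun c d => Subtype.ext <| by
      change e * (c * e * d) * e = e * c * e * (e * d * e)
      simp only [mul_assoc]
      rw [← mul_assoc e e (d * e), he.eq]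
  rw [h, map_sum]
  exact Finset.sum_congr rfl fun k _ => h2 _ _

theorem exists_le_algFiltration {T : Finset A} (hT : Generates K T) {W : Submodule K A}
    (hW : W.FG) : ∃ c, W ≤ algFiltration K T c := by
  have h1 : IsGenerating A (1 : Submodule K A) :=
    (Ideal.eq_top_iff_one _).2 (Submodule.subset_span (Submodule.one_le.1 le_rfl))
  obtain ⟨c, hc⟩ := exists_le_modFiltration hT h1 hW
  exact ⟨c, by simpa [modFiltration] using hc⟩

/-- The standard filtration of `A` is compatible with that of the corner, up to a linear change of
the index. -/
theorem exists_cornerMap_mem (hxy : ∑ k, x k * e * y k = 1) (S : Finset A)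
    {T : Finset he.Corner} (hT : Generates K T) :
    ∃ c, 0 < c ∧ ∀ i, ∀ a ∈ algFiltration K S i, ∀ k,
      cornerMap K he (y k * a) ∈ algFiltration K T (c * i + c) := by
  -- A finite dimensional space that contains all `e y_k a x_l e` with `a ∈ A_1` and all `e y_k e`;
  -- these are the factors obtained from `y_k a_1 ⋯ a_i` by inserting `∑ x_l e y_l = 1`.
  let W : Submodule K he.Corner :=
    (⨆ k, ⨆ l, (algFiltration K S 1).map
      (cornerMap K he ∘ₗ LinearMap.mulLeft K (y k) ∘ₗ LinearMap.mulRight K (x l))) ⊔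
    ⨆ k, (algFiltration K S 0).map (cornerMap K he ∘ₗ LinearMap.mulLeft K (y k))
  have hW : W.FG := Submodule.FG.sup
    (Submodule.fg_iSup _ fun k => Submodule.fg_iSup _ fun l => (algFiltration_fg S 1).map _)
    (Submodule.fg_iSup _ fun k => (algFiltration_fg S 0).map _)
  obtain ⟨c, hc⟩ := exists_le_algFiltration hT hW
  have hc := hc.trans (algFiltration_mono T (Nat.le_succ c))
  have h1 : ∀ k l, ∀ a ∈ algFiltration K S 1,
      cornerMap K he (y k * (a * x l)) ∈ algFiltration K T (c + 1) := fun k l a ha =>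
    hc (Submodule.mem_sup_left (Submodule.mem_iSup_of_mem k (Submodule.mem_iSup_of_mem l
      (Submodule.mem_map_of_mem ha))))
  refine ⟨c + 1, c.succ_pos, fun i => ?_⟩
  induction i with
  | zero =>
    intro a ha k
    rw [mul_zero, zero_add]
    exact hc (Submodule.mem_sup_right (Submodule.mem_iSup_of_mem k (Submodule.mem_map_of_mem ha)))
  | succ i ih =>
    intro a ha k
    rw [add_comm, algFiltration_add] at ha
    induction ha using Submodule.mul_induction_on' with
    | add a _ b _ ha hb => rw [mul_add (y k) a b, map_add]; exact add_mem ha hb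
    | mem_mul_mem a ha b hb =>
      rw [← mul_assoc, cornerMap_mul he hxy]
      refine sum_mem fun l _ => ?_
      rw [show (c + 1) * (i + 1) + (c + 1) = (c + 1) + ((c + 1) * i + (c + 1)) by ring,
        algFiltration_add, mul_assoc (y k)]
      exact Submodule.mul_mem_mul (h1 k l a ha) (ih b hb l)

end Corner

/-! ### The induced module -/

theorem finrank_le_card_mul_of_injective {K : Type*} {M N : Type*} [Field K] [AddCommGroup M]
    [Module K M] [AddCommGroup N] [Module K N] {ι : Type*} [Fintype ι] {φ : M →ₗ[K] ι → N}
    (hφ : Function.Injective φ) {V : Submodule K M} {W : Submodule K N} (hW : W.FG)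
    (h : ∀ v ∈ V, ∀ k, φ v k ∈ W) : Module.finrank K V ≤ Fintype.card ι * Module.finrank K W := by
  have : Module.Finite K W := Module.Finite.iff_fg.2 hW
  let ψ : V →ₗ[K] ι → W := LinearMap.pi fun k =>
    (LinearMap.proj k ∘ₗ φ ∘ₗ V.subtype).codRestrict W fun v => h v v.2 k
  have hψ : Function.Injective ψ := fun v v' hv => Subtype.ext <| hφ <| funext fun k =>
    congrArg Subtype.val (congrFun hv k)
  calc _ ≤ Module.finrank K (ι → W) := LinearMap.finrank_le_finrank_of_injective hψ
    _ = _ := by simp [Module.finrank_pi_fintype]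

section Induced

variable {K : Type w} {A : Type u} [Field K] [Ring A] [Algebra K A] {e : A}
  (he : IsIdempotentElem e) {M : Type v} [AddCommGroup M] [Module K M] [Module he.Corner M]
  [IsScalarTower K he.Corner M] {n : ℕ} (m : Fin n → M)

variable (K) in
/-- The `K`-linear map `A ^ n → M`, `f ↦ ∑ (e f_i e) m_i`. -/
noncomputable def cornerEval : (Fin n → A) →ₗ[K] M :=
  ∑ i, (LinearMap.toSpanSingleton he.Corner M (m i)).restrictScalars K ∘ₗ cornerMap K he ∘ₗ
    LinearMap.proj i

theorem cornerEval_apply (f : Fin n → A) :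
    cornerEval K he m f = ∑ i, cornerMap K he (f i) • m i := by
  simp [cornerEval]

variable (K) in
/-- The largest `A`-submodule of `A ^ n` on which `f ↦ ∑ (e f_i e) m_i` vanishes. If
`A e A = A` and the `m_i` generate the module `M` over `e A e`, then the quotient of `A ^ n` by it is
isomorphic to the module `A e ⊗ M` induced from `M`. The tensor product over the noncommutative ring
`e A e` is avoided in this way, and the quotient lives in the universe of `A` whatever that of
`M` is. -/
noncomputable def inducedRelations : Submodule A (Fin n → A) where
  carrier := {f | ∀ a : A, cornerEval K he m (a • f) = 0}
  add_mem' hf hg a := by rw [smul_add, map_add, hf a, hg a, add_zero]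
  zero_mem' a := by rw [smul_zero, map_zero]
  smul_mem' b f hf a := by rw [smul_smul]; exact hf _

/-- The induced module is nonzero: if all standard basis vectors are relations, then every `m_i` is
zero. -/
theorem inducedRelations_ne_top [Nontrivial M]
    (hm : Submodule.span he.Corner (Set.range m) = ⊤) : inducedRelations K he m ≠ ⊤ := by
  intro htop
  have h0 : ∀ i, m i = 0 := fun i => by
    have h : (Pi.single i 1 : Fin n → A) ∈ inducedRelations K he m := by rw [htop]; trivial
    have := h 1
    rw [one_smul, cornerEval_apply, Finset.sum_eq_single i
      (fun j _ hj => by rw [Pi.single_eq_of_ne hj, map_zero]; exact zero_smul he.Corner (m j))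
      (fun h => absurd (Finset.mem_univ i) h), Pi.single_eq_same, cornerMap_one, one_smul] at this
    exact this
  refine bot_ne_top (α := Submodule he.Corner M) (le_bot_iff.1 ?_).symm
  rw [← hm, Submodule.span_le]
  rintro _ ⟨i, rfl⟩
  exact h0 i

variable {ι : Type*} [Fintype ι] {x y : ι → A}

/-- The values `∑ (e y_k f_i e) m_i` determine `f` modulo the relations. -/
theorem mem_inducedRelations_iff (hxy : ∑ k, x k * e * y k = 1) (f : Fin n → A) :
    f ∈ inducedRelations K he m ↔ ∀ k, cornerEval K he m (y k • f) = 0 := by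
  refine ⟨fun h k => h _, fun h a => ?_⟩
  simp only [cornerEval_apply, Pi.smul_apply, smul_eq_mul] at h ⊢
  rw [Finset.sum_congr rfl fun i _ => by rw [cornerMap_mul he hxy, Finset.sum_smul], Finset.sum_comm]
  refine Finset.sum_eq_zero fun k _ => ?_
  simp only [mul_smul]
  rw [← Finset.smul_sum, h k, smul_zero]

variable (K) in
/-- The embedding of the induced module into `M ^ ι`, given by the elements `y_k`. -/
theorem exists_injective_of_relations (hxy : ∑ k, x k * e * y k = 1) :
    ∃ φ : ((Fin n → A) ⧸ inducedRelations K he m) →ₗ[K] ι → M, Function.Injective φ ∧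
      ∀ f k, φ (Submodule.Quotient.mk f) k = cornerEval K he m (y k • f) := by
  let ψ : (Fin n → A) →ₗ[K] ι → M := LinearMap.pi fun k =>
    cornerEval K he m ∘ₗ (Algebra.lsmul K K (Fin n → A) (y k))
  have hψ : ∀ f, f ∈ inducedRelations K he m ↔ ψ f = 0 := fun f => by
    rw [mem_inducedRelations_iff he m hxy, funext_iff]; rfl
  have hle : (inducedRelations K he m).restrictScalars K ≤ LinearMap.ker ψ :=
    fun f hf => (hψ f).1 hf
  refine ⟨((inducedRelations K he m).restrictScalars K).liftQ ψ hle, ?_, fun f k => rfl⟩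
  refine (injective_iff_map_eq_zero _).2 fun q hq => ?_
  obtain ⟨f, rfl⟩ := Submodule.Quotient.mk_surjective _ q
  exact (Submodule.Quotient.mk_eq_zero _).2 ((hψ f).2 hq)

end Induced

/-- The induced module has at most the Gelfand-Kirillov dimension of `M`, since its `i`-th layer
embeds into `(M_{c i + c}) ^ ι`. -/
theorem holonomicNumber_le_gkDim_corner {K : Type w} {A : Type u} [Field K] [Ring A] [Algebra K A]
    [IsSimpleRing A] [Algebra.FiniteType K A] {e : A} (he : IsIdempotentElem e) (he0 : e ≠ 0)
    (M : Type v) [AddCommGroup M] [Module K M] [Module he.Corner M]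
    [IsScalarTower K he.Corner M] [Module.Finite he.Corner M] [Nontrivial M] :
    holonomicNumber K A ≤ gkDim K he.Corner M := by
  obtain ⟨S, hS⟩ : ∃ S : Finset A, Generates K S := Algebra.FiniteType.out
  obtain ⟨n, m, hm⟩ := Module.Finite.exists_fin (R := he.Corner) (M := M)
  obtain ⟨ι, _, x, y, hxy⟩ := exists_sum_mul_mul_eq_one he0
  have hfg : (Submodule.span K (Set.range m)).FG := Submodule.fg_span (Set.finite_range m)
  have hgen := isGenerating_span_range K he.Corner M hm
  -- It suffices to argue for a given finite set `T` of generators of the corner; if there is none,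
  -- the right-hand side is `∞`.
  refine le_iInf₂ fun T hT => le_iInf₂ fun M₀ hM₀ => le_iInf fun hM₀' => ?_
  rw [← gkDim_eq hT hM₀ hM₀', gkDim_eq hT hfg hgen]
  set N := (Fin n → A) ⧸ inducedRelations K he m
  have hN : Nontrivial N :=
    Submodule.Quotient.nontrivial_iff.2 (inducedRelations_ne_top he m hm)
  let q : Fin n → N := fun i => Submodule.Quotient.mk (Pi.single i 1)
  have hq : Submodule.span A (Set.range q) = ⊤ := by
    refine eq_top_iff.2 fun v _ => ?_
    obtain ⟨f, rfl⟩ := Submodule.Quotient.mk_surjective _ v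
    rw [pi_eq_sum_univ' f, ← Submodule.mkQ_apply, map_sum]
    refine sum_mem fun i _ => ?_
    rw [map_smul]
    refine Submodule.smul_mem _ _ (Submodule.subset_span ⟨i, ?_⟩)
    simp only [q, Submodule.mkQ_apply]
  have hqfg : (Submodule.span K (Set.range q)).FG := Submodule.fg_span (Set.finite_range q)
  have hle : holonomicNumber K A ≤ gkDim K A N :=
    iInf_le_of_le N <| iInf_le_of_le inferInstance <| iInf_le_of_le inferInstance <|
      iInf_le_of_le inferInstance <| iInf_le_of_le inferInstance <|
      iInf_le_of_le inferInstance <| iInf_le_of_le hN le_rfl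
  refine hle.trans ?_
  rw [gkDim_eq hS hqfg (isGenerating_span_range K A N hq)]
  obtain ⟨φ, hφ, hφm⟩ := exists_injective_of_relations K he m hxy
  obtain ⟨c, hc, hcorner⟩ := exists_cornerMap_mem he hxy S hT
  refine degree_le c c (Fintype.card ι) hc fun i => ?_
  have hmap : ∀ k, modFiltration S (Submodule.span K (Set.range q)) i ≤
      (modFiltration T (Submodule.span K (Set.range m)) (c * i + c)).comap
        (LinearMap.proj k ∘ₗ φ) := fun k => by
    refine Submodule.smul_le.2 fun a ha v hv => ?_
    induction hv using Submodule.span_induction with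
    | zero => rw [smul_zero]; exact zero_mem _
    | add v w _ _ hv hw => rw [smul_add]; exact add_mem hv hw
    | smul b v _ hv => rw [smul_algebra_smul_comm]; exact Submodule.smul_mem _ b hv
    | mem v hv =>
      obtain ⟨j, rfl⟩ := hv
      have h : φ (a • q j) k = cornerMap K he (y k * a) • m j := by
        rw [← Submodule.Quotient.mk_smul, hφm, cornerEval_apply,
          Finset.sum_eq_single j (fun l _ hl => by
            rw [Pi.smul_apply, Pi.smul_apply, Pi.single_eq_of_ne hl, smul_zero, smul_zero, map_zero]
            exact zero_smul he.Corner (m l)) (fun h => absurd (Finset.mem_univ j) h)]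
        simp
      rw [Submodule.mem_comap, LinearMap.comp_apply, LinearMap.proj_apply, h]
      exact Submodule.smul_mem_smul (hcorner i a ha k) (Submodule.subset_span ⟨j, rfl⟩)
  have key := finrank_le_card_mul_of_injective hφ (modFiltration_fg T hfg (c * i + c))
    fun v hv k => hmap k hv
  exact le_add_right (by exact_mod_cast key)

end FilterDimension

theorem mainTheorem8 {K : Type*} {A : Type*} [Field K] [Ring A] [Algebra K A]
    [IsSimpleRing A] [Algebra.FiniteType K A] {e : A} (he : IsIdempotentElem e) (he0 : e ≠ 0)
    (M : Type*) [AddCommGroup M] [Module K M] [Module he.Corner M]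
    [IsScalarTower K he.Corner M] [Module.Finite he.Corner M] [Nontrivial M] :
    FilterDimension.holonomicNumber K A ≤ FilterDimension.gkDim K he.Corner M ∧
      FilterDimension.gkDimAlg K A /
          (FilterDimension.filterDimAlg K A + max (FilterDimension.filterDimAlg K A) 1) ≤
        FilterDimension.holonomicNumber K A :=
  ⟨FilterDimension.holonomicNumber_le_gkDim_corner he he0 M,
    FilterDimension.div_le_holonomicNumber K A⟩
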